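/- Let $X$ be a smooth projective toric variety over $\mathbb{C}$ of dimension $n$ with Picard group $\operatorname{Pic}(X)\simeq\mathbb{Z}^w$, let $S=\bigoplus_{D\in\operatorname{Pic}(X)}H^0(X,D)=\mathbb{C}[\alpha_1,\dots,\alpha_{n+w}]$ be its $\operatorname{Pic}(X)$-graded Cox ring, where the variables $\alpha_i$ correspond to the torus invariant prime divisors, and let $L$ be a very ample line bundle on $X$, so that $X\subset\mathbb{P}(H^0(X,L)^*)$. Write $S_D=H^0(X,D)$ and let $\widetilde S=\bigoplus_D H^0(X,D)^*$ be the graded dual of $S$, on which $S$ acts by $(\Theta\lrcorner F)(\Psi)=F(\Theta\Psi)$. For nonzero $F\in\widetilde S_L=H^0(X,L)^*$ let $F^\perp=\{\Theta\in S\mid \Theta\lrcorner F=0\}$ be the apolar ideal. The border rank $\operatorname{br}(F)$ is the least $r$ such that $[F]$ lies in the $r$-th secant variety of $X$, that is, in the Zariski closure of the set of points of $\mathbb{P}(H^0(X,L)^*)$ that lie in the linear span of at most $r$ points of $X$. We say that $F$ has minimal border rank if $F$ is concise, i.e. $(F^\perp)_{\deg\alpha_i}=0$ for all $i$, and $\operatorname{br}(F)=\max_{1\le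 i\le n+w}\dim H^0(X,\deg\alpha_i)$. **Theorem.** Suppose that $F\in\widetilde S_L$ is of minimal border rank, and let $i\in\{1,\dots,n+w\}$ be such that $\operatorname{br}(F)=\dim H^0(X,\deg\alpha_i)$. Then \[ \dim\Bigl(S_L\big/\bigl((F^\perp)_{L-\deg\alpha_i}\cdot S_{\deg\alpha_i}\bigr)\Bigr)\ \ge\ \operatorname{br}(F), \] where the product denotes the linear span of all products of an element of $(F^\perp)_{L-\deg\alpha_i}$ and an element of $S_{\deg\alpha_i}$. -/

import Mathlib

open scoped LinearAlgebra.Projectivization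

/-- The cone in `ℝⁿ` spanned by the lattice vectors `u i`, `i ∈ σ`. -/
def coneOver {n : ℕ} {ι : Type*} (u : ι → (Fin n → ℤ)) (σ : Set ι) : PointedCone ℝ (Fin n → ℝ) :=
  PointedCone.hull ℝ ((fun i k => (u i k : ℝ)) '' σ)

/-- A smooth complete toric variety, given by its fan in `N = ℤⁿ`: the rays are indexed by the finite
type `ι`, `ray i` is the primitive generator of the `i`-th ray, and `cones` lists those sets of
rays that span a cone of the fan. -/
structure SmoothToric (n : ℕ) (ι : Type*) [Fintype ι] where
  ray : ι → (Fin n → ℤ)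
  cones : Set (Set ι)
  empty_mem : ∅ ∈ cones
  /-- Every `ray i` is a cone of the fan. -/
  singleton_mem : ∀ i, {i} ∈ cones
  /-- Faces of cones of the fan are cones of the fan. -/
  face_mem : ∀ σ ∈ cones, ∀ τ ⊆ σ, τ ∈ cones
  /-- Smoothness: the generators of each cone are part of a `ℤ`-basis of `N`. -/
  smooth : ∀ σ ∈ cones, ∃ b : Module.Basis (Fin n) ℤ (Fin n → ℤ), ray '' σ ⊆ Set.range b
  /-- Two cones of the fan meet along their common face. -/
  inter : ∀ σ ∈ cones, ∀ τ ∈ cones,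
    coneOver ray σ ⊓ coneOver ray τ = coneOver ray (σ ∩ τ)
  /-- Completeness: the cones of the fan cover `N ⊗ ℝ`. -/
  complete : ∀ v : Fin n → ℝ, ∃ σ ∈ cones, v ∈ coneOver ray σ

/-- The Zariski closure of a subset of the projective space of `V`: the common zeros of all
homogeneous polynomials (in linear functionals on `V`) that vanish on the set. -/
def zariskiClosure {V : Type*} [AddCommGroup V] [Module ℂ V] (A : Set (ℙ ℂ V)) : Set (ℙ ℂ V) :=
  {P | ∀ (d : ℕ) (p : MvPolynomial (Module.Dual ℂ V) ℂ), p.IsHomogeneous d →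
    (∀ Q ∈ A, MvPolynomial.eval (fun l => l Q.rep) p = 0) →
      MvPolynomial.eval (fun l => l P.rep) p = 0}

namespace SmoothToric

variable {n : ℕ} {ι : Type*} [Fintype ι] (X : SmoothToric n ι)

/-- The map sending a character `m ∈ M = Hom(N, ℤ)` to its divisor `∑ ⟨m, uᵢ⟩ Dᵢ`. -/
def divisorMap : Module.Dual ℤ (Fin n → ℤ) →ₗ[ℤ] (ι → ℤ) :=
  LinearMap.pi fun i => Module.Dual.eval ℤ (Fin n → ℤ) (X.ray i)

/-- The Picard group: torus invariant divisors modulo divisors of characters. -/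
abbrev Pic : Type _ := (ι → ℤ) ⧸ LinearMap.range X.divisorMap

open Classical in
/-- The degree of the variable `αᵢ`: the class of the `i`-th torus invariant prime divisor. -/
noncomputable def deg (i : ι) : X.Pic := Submodule.Quotient.mk (Pi.single i 1)

/-- The Cox ring `S = ℂ[αᵢ : i ∈ ι]`. -/
abbrev Cox (_X : SmoothToric n ι) : Type _ := MvPolynomial ι ℂ

/-- The graded piece `S_D = H⁰(X, D)` of the Cox ring. -/
noncomputable def H0 (D : X.Pic) : Submodule ℂ X.Cox :=
  MvPolynomial.weightedHomogeneousSubmodule ℂ X.deg D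

/-- The graded piece `H⁰(D)*` of the graded dual of `S`: the linear functionals on `S` that
vanish on `S_E` for all `E ≠ D`. -/
noncomputable def dualPiece (D : X.Pic) : Submodule ℂ (Module.Dual ℂ X.Cox) where
  carrier := {F | ∀ E ≠ D, ∀ s ∈ X.H0 E, F s = 0}
  add_mem' := fun hF hG E hE s hs => by
    simp [hF E hE s hs, hG E hE s hs]
  zero_mem' := fun _ _ _ _ => rfl
  smul_mem' := fun c F hF E hE s hs => by
    simp [hF E hE s hs]

/-- The apolarity action: `(Θ ⌟ F)(Ψ) = F(ΘΨ)`. -/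
noncomputable def hook (Θ : X.Cox) (F : Module.Dual ℂ X.Cox) : Module.Dual ℂ X.Cox :=
  F ∘ₗ LinearMap.mulLeft ℂ Θ

/-- The apolar ideal `F^⊥ = {Θ ∈ S | Θ ⌟ F = 0}`. -/
noncomputable def apolarIdeal (F : Module.Dual ℂ X.Cox) : Ideal X.Cox where
  carrier := {Θ | X.hook Θ F = 0}
  add_mem' := fun {a b} ha hb => by
    refine LinearMap.ext fun s => ?_
    have h1 := LinearMap.congr_fun ha s
    have h2 := LinearMap.congr_fun hb s
    simp only [hook, LinearMap.comp_apply, LinearMap.mulLeft_apply, LinearMap.zero_apply]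
      at h1 h2 ⊢
    rw [add_mul, map_add, h1, h2, add_zero]
  zero_mem' := by
    refine LinearMap.ext fun s => ?_
    simp [hook]
  smul_mem' := fun c Θ hΘ => by
    refine LinearMap.ext fun s => ?_
    have h := LinearMap.congr_fun hΘ (c * s)
    simp only [hook, LinearMap.comp_apply, LinearMap.mulLeft_apply, LinearMap.zero_apply,
      smul_eq_mul] at h ⊢
    rw [← h]
    congr 1
    ring

/-- The graded piece `I_D` of an ideal `I` of the Cox ring. -/
noncomputable def piece (I : Ideal X.Cox) (D : X.Pic) : Submodule ℂ X.Cox :=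
  I.restrictScalars ℂ ⊓ X.H0 D

/-- The points of `ℂ^ι` outside the zero locus of the irrelevant ideal: the vanishing coordinates
span a cone of the fan. -/
abbrev Stable : Type _ := {z : ι → ℂ // {i | z i = 0} ∈ X.cones}

/-- Orbits of the torus `Hom(Pic X, ℂ*)` acting with the weights `deg αᵢ`. -/
def orbitSetoid : Setoid X.Stable where
  r z z' := ∃ ψ : AddChar X.Pic ℂ, ∀ i, z'.1 i = ψ (X.deg i) * z.1 i
  iseqv := by
    refine ⟨fun z => ⟨1, fun i => by simp⟩, ?_, ?_⟩
    · rintro z z' ⟨ψ, h⟩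
      refine ⟨ψ⁻¹, fun i => ?_⟩
      rw [h i, AddChar.inv_apply, ← mul_assoc, ← AddChar.map_add_eq_mul, neg_add_cancel,
        AddChar.map_zero_eq_one, one_mul]
    · rintro z z' z'' ⟨ψ, h⟩ ⟨ψ', h'⟩
      refine ⟨ψ' * ψ, fun i => ?_⟩
      rw [h' i, h i, AddChar.mul_apply, mul_assoc]

/-- The (closed) points of `X`, as the quotient of the stable points by `Hom(Pic X, ℂ*)`. -/
def Point : Type _ := Quotient X.orbitSetoid

/-- The functional on `H⁰(L)` given by evaluation of sections at `z`. -/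
noncomputable def evalAt (L : X.Pic) (z : ι → ℂ) : X.dualPiece L :=
  ⟨(MvPolynomial.aeval z).toLinearMap ∘ₗ MvPolynomial.weightedHomogeneousComponent X.deg L, by
    classical
    intro E hE s hs
    have : MvPolynomial.weightedHomogeneousComponent X.deg L s = 0 := by
      rw [MvPolynomial.weightedHomogeneousComponent_of_mem hs, if_neg (Ne.symm hE)]
    simp [this]⟩

theorem eval_char_mul (L : X.Pic) (ψ : AddChar X.Pic ℂ) (z : ι → ℂ) (s : X.Cox)
    (hs : s ∈ X.H0 L) :
    MvPolynomial.aeval (fun i => ψ (X.deg i) * z i) s = ψ L * MvPolynomial.aeval z s := by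
  rw [MvPolynomial.aeval_def, MvPolynomial.eval₂_eq', MvPolynomial.aeval_def,
    MvPolynomial.eval₂_eq', Finset.mul_sum]
  refine Finset.sum_congr rfl fun d hd => ?_
  have hw : Finsupp.weight X.deg d = L := hs (MvPolynomial.mem_support_iff.mp hd)
  have : ∏ i, ψ (X.deg i) ^ d i = ψ L := by
    rw [← hw, Finsupp.weight_apply, Finsupp.sum_fintype _ _ (by simp)]
    have h := map_prod ψ.toMonoidHom
      (fun i => Multiplicative.ofAdd (d i • X.deg i)) Finset.univ
    simp only [AddChar.toMonoidHom_apply, toAdd_prod, toAdd_ofAdd, AddChar.map_nsmul_eq_pow] at h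
    exact h.symm
  simp only [mul_pow, Finset.prod_mul_distrib, this]
  ring

/-- The line in `H⁰(L)*` spanned by evaluation of sections at a point of `X`
(it is zero at a base point of `L`). -/
noncomputable def evalLine (L : X.Pic) : X.Point → Submodule ℂ (X.dualPiece L) :=
  Quotient.lift (fun z : X.Stable => Submodule.span ℂ {X.evalAt L z.1}) (by
    rintro z z' ⟨ψ, h⟩
    have hz : z'.1 = fun i => ψ (X.deg i) * z.1 i := funext h
    have key : X.evalAt L z'.1 = ψ L • X.evalAt L z.1 := by
      refine Subtype.ext (LinearMap.ext fun s => ?_)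
      rw [hz]
      exact X.eval_char_mul L ψ z.1 _ (MvPolynomial.weightedHomogeneousComponent_mem _ _ _)
    have hu : IsUnit (ψ L) := ψ.val_isUnit L
    simp only [key]
    exact (Submodule.span_singleton_smul_eq hu _).symm)

/-- The line bundle `L` is very ample: it has no base points, and its sections separate points
and tangent vectors. The tangent space of `X` at the orbit of `z` is `ℂ^ι` modulo the tangent space
`{(c(deg αᵢ) zᵢ) | c ∈ Hom(Pic X, ℂ)}` of the orbit. -/
structure IsVeryAmple (L : X.Pic) : Prop where
  base_point_free : ∀ χ : X.Point, X.evalLine L χ ≠ ⊥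
  separates_points : Function.Injective (X.evalLine L)
  separates_tangents : ∀ (z : X.Stable) (v : ι → ℂ),
    (∃ c : ℂ, ∀ s ∈ X.H0 L,
      ∑ i, v i * MvPolynomial.aeval z.1 (MvPolynomial.pderiv i s) =
        c * MvPolynomial.aeval z.1 s) →
    ∃ c : X.Pic →+ ℂ, ∀ i, v i = c (X.deg i) * z.1 i

/-- The image of `X` in the projective space of `H⁰(L)*`. -/
def image (L : X.Pic) : Set (ℙ ℂ (X.dualPiece L)) :=
  {P | ∃ χ : X.Point, P.submodule = X.evalLine L χ}

/-- The `X`-rank: the least `r` such that `P` lies in the span of `r` points of `X`. -/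
noncomputable def rank (L : X.Pic) (P : ℙ ℂ (X.dualPiece L)) : ℕ∞ :=
  ⨅ r ∈ {r : ℕ | ∃ p : Fin r → ℙ ℂ (X.dualPiece L),
    (∀ j, p j ∈ X.image L) ∧ P.submodule ≤ ⨆ j, (p j).submodule}, (r : ℕ∞)

/-- The `r`-th secant variety: the Zariski closure of the set of points of `X`-rank at most `r`. -/
def secantVariety (L : X.Pic) (r : ℕ) : Set (ℙ ℂ (X.dualPiece L)) :=
  zariskiClosure {P | X.rank L P ≤ r}

/-- The `X`-border rank: the least `r` such that `P` lies in the `r`-th secant variety. -/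
noncomputable def borderRank (L : X.Pic) (P : ℙ ℂ (X.dualPiece L)) : ℕ∞ :=
  ⨅ r ∈ {r : ℕ | P ∈ X.secantVariety L r}, (r : ℕ∞)

/-- `F` is concise: no nonzero section of degree `deg αᵢ`, for any `i`, annihilates `F`. -/
def Concise (F : Module.Dual ℂ X.Cox) : Prop :=
  ∀ i, X.piece (X.apolarIdeal F) (X.deg i) = ⊥

/-- `F` has minimal border rank: it is concise and its border rank equals the maximum of
`dim H⁰(deg αᵢ)` over all `i`. -/
def HasMinimalBorderRank (L : X.Pic) (F : X.dualPiece L) (hF : F ≠ 0) : Prop :=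
  X.Concise F.1 ∧
    X.borderRank L (Projectivization.mk ℂ F hF) =
      ⨆ i, (Module.finrank ℂ (X.H0 (X.deg i)) : ℕ∞)

end SmoothToric

/-! Put $E=\deg\alpha_i$, $D=L-E$, $r=\dim S_E$. Conciseness gives $b_a\in S_D$ dual to a basis
$e_j$ of $S_E$ under $(x,y)\mapsto F(xy)$. For $G\in S_L^*$ with $M(G)=(G(b_ae_j))$ invertible,
Cramer's rule deforms each $k\in(F^\perp)_D$ polynomially in $G$ to some $k_G\in S_D$ orthogonal to
$S_E$ under $G$, with $k_F=k$. If moreover $G$ is a combination of at most $r$ point evaluations,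
then invertibility of $M(G)$ forces exactly $r$ points, imposing independent conditions on $S_L$,
and every $k_G$ vanishes at them. So the products $k_Gy$, $y\in S_E$, span at most $\dim S_L-r$
dimensions (`finrank_add_card_le_of_pairing`). Linear independence of products is an open condition,
so this bound passes to the Zariski closure, hence to $F$ (`finrank_add_finrank_mul_le`). -/

/-! ### Homogeneous polynomial functions on a vector space. -/

/-- `f` is a homogeneous polynomial function of degree `d` on `V`. -/
def IsFormOfDegree {V : Type*} [AddCommGroup V] [Module ℂ V] (d : ℕ) (f : V → ℂ) : Prop :=
  ∃ p : MvPolynomial (Module.Dual ℂ V) ℂ, p.IsHomogeneous d ∧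
    ∀ v, MvPolynomial.eval (fun l => l v) p = f v

namespace IsFormOfDegree

variable {V : Type*} [AddCommGroup V] [Module ℂ V] {d e : ℕ} {f g : V → ℂ}

theorem linear (l : Module.Dual ℂ V) : IsFormOfDegree 1 (fun v => l v) :=
  ⟨MvPolynomial.X l, MvPolynomial.isHomogeneous_X _ _, fun v => by simp⟩

theorem mul (hf : IsFormOfDegree d f) (hg : IsFormOfDegree e g) :
    IsFormOfDegree (d + e) (fun v => f v * g v) := by
  obtain ⟨p, hp, hpf⟩ := hf
  obtain ⟨q, hq, hqg⟩ := hg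
  exact ⟨p * q, hp.mul hq, fun v => by simp [hpf, hqg]⟩

theorem const_mul (c : ℂ) (hf : IsFormOfDegree d f) : IsFormOfDegree d (fun v => c * f v) := by
  obtain ⟨p, hp, hpf⟩ := hf
  refine ⟨MvPolynomial.C c * p, ?_, fun v => by simp [hpf]⟩
  simpa using (MvPolynomial.isHomogeneous_C _ c).mul hp

theorem sub (hf : IsFormOfDegree d f) (hg : IsFormOfDegree d g) :
    IsFormOfDegree d (fun v => f v - g v) := by
  obtain ⟨p, hp, hpf⟩ := hf
  obtain ⟨q, hq, hqg⟩ := hg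
  exact ⟨p - q, hp.sub hq, fun v => by simp [hpf, hqg]⟩

theorem sum {κ : Type*} (s : Finset κ) {f : κ → V → ℂ} (hf : ∀ k, IsFormOfDegree d (f k)) :
    IsFormOfDegree d (fun v => ∑ k ∈ s, f k v) := by
  choose p hp hpf using hf
  exact ⟨∑ k ∈ s, p k, MvPolynomial.IsHomogeneous.sum _ _ _ fun k _ => hp k,
    fun v => by simp [hpf]⟩

theorem prod {κ : Type*} (s : Finset κ) {f : κ → V → ℂ} (hf : ∀ k, IsFormOfDegree d (f k)) :
    IsFormOfDegree (∑ _k ∈ s, d) (fun v => ∏ k ∈ s, f k v) := by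
  choose p hp hpf using hf
  exact ⟨∏ k ∈ s, p k, MvPolynomial.IsHomogeneous.prod _ _ _ fun k _ => hp k,
    fun v => by simp [hpf]⟩

theorem det {κ : Type*} [Fintype κ] [DecidableEq κ] {M : V → Matrix κ κ ℂ}
    (hM : ∀ i j, IsFormOfDegree d (fun v => M v i j)) :
    IsFormOfDegree (∑ _k : κ, d) (fun v => (M v).det) := by
  simp only [Matrix.det_apply']
  exact sum _ fun σ => const_mul _ (prod _ fun i => hM (σ i) i)

end IsFormOfDegree

/-! ### Deforming annihilators by Cramer's rule. -/

section Cramer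

variable {A : Type*} [CommRing A] [Algebra ℂ A] {κ : Type*} [Fintype κ] [DecidableEq κ]

/-- The matrix of the catalecticant pairing `(x, y) ↦ G (x * y)` on two finite families. -/
def pairingMatrix (b e : κ → A) (G : Module.Dual ℂ A) : Matrix κ κ ℂ :=
  Matrix.of fun j a => G (b a * e j)

/-- The combination of `k` and the `b a`, with coefficients polynomial in `G`, that is orthogonal
to every `e j` under the pairing `(x, y) ↦ G (x * y)`. -/
noncomputable def cramerElement (b e : κ → A) (G : Module.Dual ℂ A) (k : A) : A :=
  (pairingMatrix b e G).det • k -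
    ∑ a, Matrix.cramer (pairingMatrix b e G) (fun j => G (k * e j)) a • b a

/-- Cramer's rule without division: the identity holds even where the pairing matrix is singular. -/
theorem apply_cramerElement_mul (b e : κ → A) (G : Module.Dual ℂ A) (k : A) (j : κ) :
    G (cramerElement b e G k * e j) = 0 := by
  have h := congrFun (Matrix.mulVec_cramer (pairingMatrix b e G) (fun j => G (k * e j))) j
  simp only [Matrix.mulVec, dotProduct, Pi.smul_apply, smul_eq_mul] at h
  simp only [cramerElement, sub_mul, Finset.sum_mul, smul_mul_assoc, map_sub, map_sum, map_smul,
    smul_eq_mul]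
  rw [← h, sub_eq_zero]
  exact Finset.sum_congr rfl fun a _ => mul_comm _ _

/-- Used at $G=F$, where the determinant is 1: the deformation starts at the given annihilator. -/
theorem cramerElement_of_orthogonal (b e : κ → A) (G : Module.Dual ℂ A) (k : A)
    (hk : ∀ j, G (k * e j) = 0) :
    cramerElement b e G k = (pairingMatrix b e G).det • k := by
  have : (fun j => G (k * e j)) = 0 := funext hk
  simp [cramerElement, this]

theorem cramerElement_mem (b e : κ → A) (G : Module.Dual ℂ A) (k : A) (P : Submodule ℂ A)
    (hb : ∀ a, b a ∈ P) (hk : k ∈ P) : cramerElement b e G k ∈ P :=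
  P.sub_mem (P.smul_mem _ hk) (P.sum_mem fun a _ => P.smul_mem _ (hb a))

theorem isFormOfDegree_det_pairingMatrix (b e : κ → A) (V : Submodule ℂ (Module.Dual ℂ A)) :
    IsFormOfDegree (∑ _k : κ, 1) (fun G : V => (pairingMatrix b e G.1).det) :=
  IsFormOfDegree.det fun j a =>
    IsFormOfDegree.linear (Module.Dual.eval ℂ A (b a * e j) ∘ₗ V.subtype)

/-- Both terms have degree $|\kappa|$ in $G$: a Cramer coefficient is the same determinant with one
column replaced by another column linear in $G$. -/
theorem isFormOfDegree_cramerElement (b e : κ → A) (V : Submodule ℂ (Module.Dual ℂ A)) (k y : A)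
    (φ : Module.Dual ℂ A) :
    IsFormOfDegree (∑ _k : κ, 1) (fun G : V => φ (cramerElement b e G.1 k * y)) := by
  simp only [cramerElement, sub_mul, Finset.sum_mul, smul_mul_assoc, map_sub, map_sum, map_smul,
    smul_eq_mul]
  refine IsFormOfDegree.sub ?_ (IsFormOfDegree.sum _ fun a => ?_)
  · simp only [mul_comm _ (φ (k * y))]
    exact (isFormOfDegree_det_pairingMatrix b e V).const_mul _
  · simp only [mul_comm _ (φ (b a * y)), Matrix.cramer_apply]
    refine (IsFormOfDegree.det fun i j => ?_).const_mul _
    by_cases h : j = a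
    · subst h
      simp only [Matrix.updateCol_self]
      exact IsFormOfDegree.linear (Module.Dual.eval ℂ A (k * e i) ∘ₗ V.subtype)
    · simp only [Matrix.updateCol_ne h]
      exact IsFormOfDegree.linear (Module.Dual.eval ℂ A (b j * e i) ∘ₗ V.subtype)

end Cramer

/-! ### Linear algebra of weighted point evaluations. -/

/-- A linearly independent family admits a dual family of functionals. -/
theorem LinearIndependent.exists_dual_family {K W κ : Type*} [Field K] [AddCommGroup W]
    [Module K W] [DecidableEq κ] {v : κ → W} (hv : LinearIndependent K v) :
    ∃ φ : κ → Module.Dual K W, ∀ s t, φ s (v t) = (1 : Matrix κ κ K) s t := by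
  classical
  have hinj := hv.injective
  let B := Module.Basis.extend hv.linearIndepOn_id
  have hmem : ∀ s, v s ∈ hv.linearIndepOn_id.extend (Set.subset_univ _) := fun s =>
    hv.linearIndepOn_id.subset_extend _ ⟨s, rfl⟩
  refine ⟨fun s => B.coord ⟨v s, hmem s⟩, fun s t => ?_⟩
  have ht : v t = B ⟨v t, hmem t⟩ := by simp [B]
  rw [ht, Module.Basis.coord_apply, B.repr_self, Finsupp.single_apply, Matrix.one_apply]
  simp [hinj.eq_iff, eq_comm]

theorem Matrix.mul_diagonal_mul_apply {K l m o : Type*} [CommRing K] [Fintype m] [DecidableEq m]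
    (A : Matrix l m K) (c : m → K) (B : Matrix m o K) (i : l) (j : o) :
    (A * (Matrix.diagonal c * B)) i j = ∑ k, A i k * (c k * B k j) := by
  rw [Matrix.mul_apply]
  exact Finset.sum_congr rfl fun k _ => by rw [Matrix.diagonal_mul]

/-- If the Gram matrix of two families of functions at `r` weighted points is invertible, then
products of the functions have independent values at these points. -/
theorem finrank_add_card_le_of_pairing {A : Type*} [CommRing A] [Algebra ℂ A] {r r' : ℕ}
    (hr : r' ≤ r) (z : Fin r' → A →ₐ[ℂ] ℂ) (c : Fin r' → ℂ) (b e : Fin r → A)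
    (G : Module.Dual ℂ A) (P : Submodule ℂ A) [FiniteDimensional ℂ P]
    (hP : ∀ a j, b a * e j ∈ P)
    (hG : ∀ p ∈ P, G p = ∑ j, c j * z j p)
    (hdet : (pairingMatrix b e G).det ≠ 0) {κ : Type*} [Fintype κ] (k y : κ → A)
    (hk : ∀ t, ∀ j, k t * e j ∈ P) (hky : ∀ t, k t * y t ∈ P)
    (hker : ∀ t, ∀ j, G (k t * e j) = 0)
    (hind : LinearIndependent ℂ fun t => k t * y t) :
    r + Fintype.card κ ≤ Module.finrank ℂ P := by
  let E : Matrix (Fin r) (Fin r') ℂ := Matrix.of fun j l => z l (e j)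
  let B : Matrix (Fin r') (Fin r) ℂ := Matrix.of fun l a => z l (b a)
  have hM : pairingMatrix b e G = E * (Matrix.diagonal c * B) := by
    ext j a
    rw [Matrix.mul_diagonal_mul_apply]
    simp only [pairingMatrix, Matrix.of_apply, hG _ (hP a j), E, B, map_mul]
    exact Finset.sum_congr rfl fun l _ => by ring
  have hrank : (pairingMatrix b e G).rank = r := by
    rw [Matrix.rank_of_isUnit _ ((Matrix.isUnit_iff_isUnit_det _).2 hdet.isUnit)]
    simp
  -- An invertible $r\times r$ matrix cannot factor through fewer than $r$ points.
  have hrr : r = r' := by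
    refine le_antisymm ?_ hr
    rw [← hrank, hM]
    exact (Matrix.rank_mul_le_left _ _).trans (Matrix.rank_le_width _)
  subst hrr
  have hE : E.det ≠ 0 := by
    intro h
    exact hdet (by rw [hM, Matrix.det_mul, h, zero_mul])
  have hB : B.det ≠ 0 := by
    intro h
    exact hdet (by rw [hM, Matrix.det_mul, Matrix.det_mul, h, mul_zero, mul_zero])
  have hc : ∀ l, c l ≠ 0 := by
    intro l h
    apply hdet
    rw [hM, Matrix.det_mul, Matrix.det_mul, Matrix.det_diagonal,
      Finset.prod_eq_zero (Finset.mem_univ l) h, zero_mul, mul_zero]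
  -- Orthogonality to all `e j` says that `E` kills the vector of weighted values of `k t`; `E` is
  -- invertible and no weight vanishes.
  have hkz : ∀ t l, z l (k t) = 0 := by
    intro t l
    have h0 : E.mulVec (fun l => c l * z l (k t)) = 0 := by
      ext j
      have := hker t j
      rw [hG _ (hk t j)] at this
      simp only [Matrix.mulVec, dotProduct, E, Matrix.of_apply, Pi.zero_apply]
      rw [← this]
      exact Finset.sum_congr rfl fun l _ => by rw [map_mul]; ring
    have := congrFun (Matrix.eq_zero_of_mulVec_eq_zero hE h0) l
    simpa [hc l] using this
  let T : P →ₗ[ℂ] (Fin r → ℂ) := LinearMap.pi fun l => (z l).toLinearMap ∘ₗ P.subtype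
  -- A functional `q` vanishing on the values of all `b a * e j` satisfies `E * diagonal q * B = 0`,
  -- so `q = 0`.
  have hT : LinearMap.range T = ⊤ := by
    by_contra hne
    obtain ⟨f, hf0, hf⟩ := Submodule.exists_le_ker_of_lt_top _ (lt_top_iff_ne_top.2 hne)
    apply hf0
    let q : Fin r → ℂ := fun l => f (Pi.single l 1)
    have hfq : ∀ x, f x = ∑ l, x l * q l := by
      intro x
      conv_lhs => rw [pi_eq_sum_univ' x]
      simp [q]
    have h0 : E * (Matrix.diagonal q * B) = 0 := by
      ext j a
      have : f (T ⟨b a * e j, hP a j⟩) = 0 := hf ⟨_, rfl⟩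
      rw [hfq] at this
      rw [Matrix.mul_diagonal_mul_apply]
      simp only [E, B, Matrix.of_apply, Matrix.zero_apply]
      rw [← this]
      refine Finset.sum_congr rfl fun l _ => ?_
      simp [T]
      ring
    have hEu : IsUnit E := (Matrix.isUnit_iff_isUnit_det _).2 hE.isUnit
    have hBu : IsUnit B := (Matrix.isUnit_iff_isUnit_det _).2 hB.isUnit
    have hq : Matrix.diagonal q = 0 := by
      rw [← hBu.mul_left_eq_zero, ← hEu.mul_right_eq_zero]
      exact h0
    have hq' : q = 0 := by simpa using hq
    ext l
    simpa using congrFun hq' l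
  have hdim := LinearMap.finrank_range_add_finrank_ker T
  rw [hT, finrank_top, Module.finrank_fin_fun] at hdim
  rw [← hdim]
  gcongr
  let w : κ → LinearMap.ker T := fun t => ⟨⟨k t * y t, hky t⟩, by
    rw [LinearMap.mem_ker]
    ext l
    simp [T, hkz]⟩
  have hw : LinearIndependent ℂ w :=
    LinearIndependent.of_comp (P.subtype ∘ₗ (LinearMap.ker T).subtype) hind
  exact hw.fintype_card_le_finrank

/-! ### Finite-dimensionality of the graded pieces of the Cox ring. -/

namespace SmoothToric

variable {n : ℕ} {ι : Type*} [Fintype ι] (X : SmoothToric n ι)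

/-- A vector of the cone is a nonnegative combination of rays, so lower bounds on the rays add up.
Applied to $v=-u_i$, it bounds the polytope of sections from above along $u_i$. -/
theorem exists_lower_bound_of_mem_coneOver (d : ι → ℝ) {σ : Set ι} {v : Fin n → ℝ}
    (hv : v ∈ coneOver X.ray σ) :
    ∃ C : ℝ, ∀ m : Fin n → ℝ, (∀ i, -d i ≤ ∑ k, X.ray i k * m k) → -C ≤ ∑ k, v k * m k := by
  refine Submodule.span_induction (p := fun v _ => ∃ C : ℝ, ∀ m : Fin n → ℝ,
    (∀ i, -d i ≤ ∑ k, X.ray i k * m k) → -C ≤ ∑ k, v k * m k) ?_ ?_ ?_ ?_ hv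
  · rintro _ ⟨i, -, rfl⟩
    exact ⟨d i, fun m hm => hm i⟩
  · exact ⟨0, fun m _ => by simp⟩
  · rintro x y - - ⟨C, hC⟩ ⟨C', hC'⟩
    refine ⟨C + C', fun m hm => ?_⟩
    simp only [Pi.add_apply, add_mul, Finset.sum_add_distrib]
    linarith [hC m hm, hC' m hm]
  · rintro a x - ⟨C, hC⟩
    refine ⟨a * C, fun m hm => ?_⟩
    have h : ∑ k, (a • x) k * m k = a * ∑ k, x k * m k := by
      rw [Finset.mul_sum]
      exact Finset.sum_congr rfl fun k _ => mul_assoc _ _ _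
    rw [h, ← mul_neg]
    exact mul_le_mul_of_nonneg_left (hC m hm) a.2

open Classical in
theorem weight_deg (d : ι →₀ ℕ) :
    Finsupp.weight X.deg d = Submodule.Quotient.mk (fun i => (d i : ℤ)) := by
  have h : (fun i => (d i : ℤ)) = ∑ i, d i • (Pi.single i 1 : ι → ℤ) := by
    ext j
    simp [Finset.sum_apply, Pi.single_apply]
  rw [Finsupp.weight_apply, Finsupp.sum_fintype _ _ (by simp), h]
  exact (map_sum (Submodule.mkQ (LinearMap.range X.divisorMap)) _ _).symm

/-- On a complete toric variety there are finitely many monomials in each degree. -/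
theorem finite_setOf_weight_eq (D : X.Pic) : {d : ι →₀ ℕ | Finsupp.weight X.deg d = D}.Finite := by
  classical
  rcases Set.eq_empty_or_nonempty {d : ι →₀ ℕ | Finsupp.weight X.deg d = D} with h | ⟨d₀, hd₀⟩
  · simp [h]
  have hbound : ∀ i, ∃ C : ℝ, ∀ m : Fin n → ℝ,
      (∀ j, -(d₀ j : ℝ) ≤ ∑ k, X.ray j k * m k) → -C ≤ ∑ k, -(X.ray i k : ℝ) * m k := by
    intro i
    obtain ⟨σ, -, hσ⟩ := X.complete fun k => -(X.ray i k : ℝ)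
    exact X.exists_lower_bound_of_mem_coneOver _ hσ
  choose C hC using hbound
  -- Exponents of equal degree differ by a character $m$, with $\langle
  -- m,u_j\rangle=d_j-d_{0,j}\ge-d_{0,j}$. The bound for $-u_i$ then gives $d_i\le d_{0,i}+C_i$.
  refine (Set.finite_Icc 0 (Finsupp.equivFunOnFinite.symm fun i => ⌊d₀ i + C i⌋₊)).subset ?_
  refine fun d hd => ⟨zero_le, fun i => ?_⟩
  have hdd : Submodule.Quotient.mk (p := LinearMap.range X.divisorMap) (fun i => (d i : ℤ)) =
      Submodule.Quotient.mk (fun i => (d₀ i : ℤ)) := by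
    rw [← weight_deg, ← weight_deg]
    exact hd.trans hd₀.symm
  obtain ⟨m, hm⟩ := (Submodule.Quotient.eq _).1 hdd
  let μ : Fin n → ℝ := fun k => m (Pi.single k 1)
  have hμ : ∀ j, ∑ k, (X.ray j k : ℝ) * μ k = d j - d₀ j := by
    intro j
    have h1 : m (X.ray j) = d j - d₀ j := congrFun hm j
    rw [pi_eq_sum_univ' (X.ray j)] at h1
    simp only [map_sum, map_smul, smul_eq_mul] at h1
    simpa [μ] using congrArg (Int.cast : ℤ → ℝ) h1
  have h := hC i μ fun j => by
    rw [hμ]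
    have : (0 : ℝ) ≤ d j := Nat.cast_nonneg _
    linarith
  simp only [neg_mul, Finset.sum_neg_distrib, hμ] at h
  exact Nat.le_floor (show (d i : ℝ) ≤ d₀ i + C i by linarith)

instance finiteDimensional_H0 (D : X.Pic) : FiniteDimensional ℂ (X.H0 D) := by
  have := FiniteDimensional.span_of_finite ℂ
    ((X.finite_setOf_weight_eq D).image fun d => MvPolynomial.monomial d (1 : ℂ))
  refine Submodule.finiteDimensional_of_le (fun s hs => ?_) (S₂ := Submodule.span ℂ
    ((fun d => MvPolynomial.monomial d (1 : ℂ)) '' {d | Finsupp.weight X.deg d = D}))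
  rw [s.as_sum]
  refine Submodule.sum_mem _ fun d hd => ?_
  have h : MvPolynomial.monomial d (s.coeff d) =
      s.coeff d • MvPolynomial.monomial d (1 : ℂ) := by
    rw [MvPolynomial.smul_monomial, smul_eq_mul, mul_one]
  rw [h]
  exact Submodule.smul_mem _ _
    (Submodule.subset_span ⟨d, hs (MvPolynomial.mem_support_iff.1 hd), rfl⟩)

/-! ### Apolarity and point evaluations in the Cox ring. -/

variable {X}

theorem mul_mem_H0 {L D E : X.Pic} (hDE : D + E = L) {s t : X.Cox} (hs : s ∈ X.H0 D)
    (ht : t ∈ X.H0 E) : s * t ∈ X.H0 L := by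
  subst hDE
  exact MvPolynomial.IsWeightedHomogeneous.mul hs ht

theorem mem_apolarIdeal {F : Module.Dual ℂ X.Cox} {s : X.Cox} :
    s ∈ X.apolarIdeal F ↔ ∀ t, F (s * t) = 0 :=
  ⟨fun h t => LinearMap.congr_fun h t, fun h => LinearMap.ext h⟩

/-- Apolarity of a homogeneous element is tested in the complementary degree. -/
theorem mem_apolarIdeal_of_mem_H0 {L D E : X.Pic} (hDE : E + D = L) {F : Module.Dual ℂ X.Cox}
    (hF : F ∈ X.dualPiece L) {s : X.Cox} (hs : s ∈ X.H0 E)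
    (h : ∀ t ∈ X.H0 D, F (s * t) = 0) : s ∈ X.apolarIdeal F := by
  classical
  refine mem_apolarIdeal.2 fun t => ?_
  induction t using MvPolynomial.induction_on' with
  | monomial d a =>
    have hd : MvPolynomial.monomial d a ∈ X.H0 (Finsupp.weight X.deg d) :=
      MvPolynomial.isWeightedHomogeneous_monomial _ _ _ rfl
    by_cases hD : Finsupp.weight X.deg d = D
    · exact h _ (hD ▸ hd)
    · refine hF _ (fun h' => hD ?_) _ (mul_mem_H0 rfl hs hd)
      exact add_left_cancel (h'.trans hDE.symm)
  | add p q hp hq => rw [mul_add, map_add, hp, hq, add_zero]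

theorem evalAt_apply {L : X.Pic} (z : ι → ℂ) {s : X.Cox} (hs : s ∈ X.H0 L) :
    (X.evalAt L z).1 s = MvPolynomial.aeval z s := by
  classical
  have h : MvPolynomial.weightedHomogeneousComponent X.deg L s = s := by
    rw [MvPolynomial.weightedHomogeneousComponent_of_mem hs, if_pos rfl]
  change MvPolynomial.aeval z (MvPolynomial.weightedHomogeneousComponent X.deg L s) = _
  rw [h]

theorem exists_rep_eq_sum_of_rank_le {L : X.Pic} {P : ℙ ℂ (X.dualPiece L)} {r : ℕ}
    (h : X.rank L P ≤ r) :
    ∃ r' ≤ r, ∃ (z : Fin r' → ι → ℂ) (c : Fin r' → ℂ), P.rep = ∑ j, c j • X.evalAt L (z j) := by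
  -- The strict bound by `r + 1` extracts an actual member `r' ≤ r` from the infimum.
  have h' : X.rank L P < ((r + 1 : ℕ) : ℕ∞) := h.trans_lt (by exact_mod_cast Nat.lt_succ_self r)
  simp only [rank, iInf_lt_iff] at h'
  obtain ⟨r', ⟨p, hp, hP⟩, hr'⟩ := h'
  refine ⟨r', Nat.lt_succ_iff.1 (by exact_mod_cast hr'), ?_⟩
  have hz : ∀ j, ∃ z : ι → ℂ, (p j).submodule = Submodule.span ℂ {X.evalAt L z} := by
    intro j
    obtain ⟨χ, hχ⟩ := hp j
    induction χ using Quotient.inductionOn with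
    | h z => exact ⟨z.1, hχ⟩
  choose z hz using hz
  refine ⟨z, ?_⟩
  have hmem : P.rep ∈ Submodule.span ℂ (Set.range fun j => X.evalAt L (z j)) := by
    have : P.rep ∈ P.submodule := by
      rw [Projectivization.submodule_eq]
      exact Submodule.mem_span_singleton_self _
    have := hP this
    simp only [hz] at this
    rwa [← Submodule.span_iUnion, Set.iUnion_singleton_eq_range] at this
  obtain ⟨c, hc⟩ := (Submodule.mem_span_range_iff_exists_fun ℂ).1 hmem
  exact ⟨c, hc.symm⟩

/-- For `F` with injective catalecticant on `S_E`, every basis of `S_E` has a dual family in the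
complementary degree. -/
theorem exists_dual_family_of_piece_eq_bot {L D E : X.Pic} (hDE : D + E = L)
    {F : Module.Dual ℂ X.Cox} (hF : F ∈ X.dualPiece L) (hE : X.piece (X.apolarIdeal F) E = ⊥)
    {κ : Type*} [Fintype κ] [DecidableEq κ] (e : Module.Basis κ ℂ (X.H0 E)) :
    ∃ b : κ → X.Cox, (∀ a, b a ∈ X.H0 D) ∧ pairingMatrix b (fun j => (e j : X.Cox)) F = 1 := by
  let T : X.H0 D →ₗ[ℂ] (κ → ℂ) :=
    LinearMap.pi fun j => F ∘ₗ LinearMap.mulRight ℂ (e j : X.Cox) ∘ₗ (X.H0 D).subtype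
  have hT : LinearMap.range T = ⊤ := by
    by_contra hne
    obtain ⟨f, hf0, hf⟩ := Submodule.exists_le_ker_of_lt_top _ (lt_top_iff_ne_top.2 hne)
    apply hf0
    -- A functional vanishing on the range of `T` is the coordinate vector of an element of $S_E$
    -- annihilating $F$, which must be zero.
    let q : κ → ℂ := fun l => f (Pi.single l 1)
    have hfq : ∀ x, f x = ∑ l, x l * q l := by
      intro x
      conv_lhs => rw [pi_eq_sum_univ' x]
      simp [q]
    let s : X.H0 E := ∑ l, q l • e l
    have hs : (s : X.Cox) ∈ X.piece (X.apolarIdeal F) E := by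
      refine ⟨mem_apolarIdeal_of_mem_H0 (D := D) (by rw [add_comm, hDE]) hF s.2 fun t ht => ?_, s.2⟩
      have h0 : f (T ⟨t, ht⟩) = 0 := hf ⟨_, rfl⟩
      rw [hfq] at h0
      rw [← h0, mul_comm]
      simp only [s, Submodule.coe_sum, Submodule.coe_smul, Finset.mul_sum, mul_smul_comm, map_sum,
        map_smul, smul_eq_mul]
      exact Finset.sum_congr rfl fun l _ => mul_comm _ _
    rw [hE, Submodule.mem_bot, ZeroMemClass.coe_eq_zero] at hs
    have hq : ∀ l, q l = 0 := Fintype.linearIndependent_iff.1 e.linearIndependent q hs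
    ext l
    simpa using hq l
  have hsurj : ∀ a : κ, ∃ b : X.H0 D, T b = Pi.single a 1 := fun a => by
    have : Pi.single a 1 ∈ LinearMap.range T := hT ▸ Submodule.mem_top
    exact this
  choose b hb using hsurj
  refine ⟨fun a => b a, fun a => (b a).2, ?_⟩
  ext j a
  have := congrFun (hb a) j
  rw [Matrix.one_apply]
  simpa [pairingMatrix, T, Pi.single_apply] using this

/-! ### Passage to the secant variety. -/

open scoped Pointwise in
/-- If `F` lies in the `r`-th secant variety, where `r = dim S_E` and no nonzero element of `S_E`
annihilates `F`, then `(F^⊥)_D · S_E` has codimension at least `r` in `S_{D + E}`. -/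
theorem finrank_add_finrank_mul_le {L D E : X.Pic} (hDE : D + E = L) {P : ℙ ℂ (X.dualPiece L)}
    {r : ℕ} (hP : P ∈ X.secantVariety L r) (hr : r ≤ Module.finrank ℂ (X.H0 E))
    (hE : X.piece (X.apolarIdeal P.rep.1) E = ⊥) :
    Module.finrank ℂ (X.H0 E) +
        Module.finrank ℂ ↥(X.piece (X.apolarIdeal P.rep.1) D * X.H0 E) ≤
      Module.finrank ℂ (X.H0 L) := by
  classical
  set F := P.rep
  set W := X.piece (X.apolarIdeal F.1) D * X.H0 E with hW
  let e := Module.finBasis ℂ (X.H0 E)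
  obtain ⟨b, hbD, hb⟩ := exists_dual_family_of_piece_eq_bot hDE F.2 hE e
  have hWL : W ≤ X.H0 L := by
    rw [hW, Submodule.mul_le]
    exact fun k hk y hy => mul_mem_H0 hDE hk.2 hy
  -- The basis of `W` is chosen among pure products $k\cdot y$, so that it can be deformed through
  -- its factors $k$.
  obtain ⟨B, hBsub, hBspan, hBind⟩ := exists_linearIndependent ℂ
    ((X.piece (X.apolarIdeal F.1) D : Set X.Cox) * (X.H0 E : Set X.Cox))
  have hspan : Submodule.span ℂ B = W := by
    rw [hBspan, hW, Submodule.mul_eq_span_mul_set]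
  have hfinW : FiniteDimensional ℂ W := Submodule.finiteDimensional_of_le hWL
  have hBfin : Finite B := by
    have hfinB : FiniteDimensional ℂ (Submodule.span ℂ (Set.range ((↑) : B → X.Cox))) := by
      rw [Subtype.range_coe, hspan]
      exact hfinW
    exact Module.Finite.finite_basis (Module.Basis.span hBind)
  have := Fintype.ofFinite B
  have hcard : Module.finrank ℂ W = Fintype.card B := by
    have h := finrank_span_eq_card hBind
    rwa [Subtype.range_coe, hspan] at h
  have hprod : ∀ t : B, ∃ k ∈ X.piece (X.apolarIdeal F.1) D, ∃ y ∈ X.H0 E, k * y = t :=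
    fun t => Set.mem_mul.1 (hBsub t.2)
  choose k hk y hy hky using hprod
  obtain ⟨φ, hφ⟩ := hBind.exists_dual_family
  let e' : Fin (Module.finrank ℂ (X.H0 E)) → X.Cox := fun j => e j
  -- Deformed basis against the dual functionals: `(N G).det ≠ 0` certifies that the deformed
  -- products are independent.
  let N : X.dualPiece L → Matrix B B ℂ := fun G =>
    Matrix.of fun s t => φ s (cramerElement b e' G.1 (k t) * y t)
  have hNF : N F = 1 := by
    ext s t
    have h0 : ∀ j, F.1 (k t * e' j) = 0 := fun j => mem_apolarIdeal.1 (hk t).1 _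
    simp only [N, Matrix.of_apply]
    rw [cramerElement_of_orthogonal _ _ _ _ h0, hb, Matrix.det_one, one_smul, hky, hφ]
  -- The form $\det M\cdot\det N$ equals 1 at `F`; if the bound failed, it would vanish at all
  -- points of rank at most `r`, hence at `F`.
  obtain ⟨p, hp, hpeval⟩ := (isFormOfDegree_det_pairingMatrix b e' (X.dualPiece L)).mul
    (IsFormOfDegree.det (M := N) fun s t =>
      isFormOfDegree_cramerElement b e' (X.dualPiece L) (k t) (y t) (φ s))
  by_contra hlt
  have hvan := hP _ p hp fun Q hQ => by
    rw [hpeval]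
    by_contra hne
    obtain ⟨hM, hN⟩ := mul_ne_zero_iff.1 hne
    obtain ⟨r', hr', z, c, hzc⟩ := exists_rep_eq_sum_of_rank_le hQ
    have hcD : ∀ t, cramerElement b e' Q.rep.1 (k t) ∈ X.H0 D := fun t =>
      cramerElement_mem _ _ _ _ _ hbD (hk t).2
    apply hlt
    rw [hcard]
    refine finrank_add_card_le_of_pairing (hr'.trans hr) (fun j => MvPolynomial.aeval (z j)) c b e'
      Q.rep.1 (X.H0 L) (fun a j => mul_mem_H0 hDE (hbD a) (e j).2) (fun s hs => ?_) hM
      (fun t => cramerElement b e' Q.rep.1 (k t)) y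
      (fun t j => mul_mem_H0 hDE (hcD t) (e j).2)
      (fun t => mul_mem_H0 hDE (hcD t) (hy t))
      (fun t j => apply_cramerElement_mul b e' _ _ j) ?_
    · rw [hzc]
      simp only [Submodule.coe_sum, Submodule.coe_smul, LinearMap.sum_apply, LinearMap.smul_apply,
        smul_eq_mul, evalAt_apply _ hs]
    · rw [Fintype.linearIndependent_iff]
      intro g hg t
      refine congrFun (Matrix.eq_zero_of_mulVec_eq_zero hN (v := g) ?_) t
      ext s
      have h := congrArg (φ s) hg
      simp only [Matrix.mulVec, dotProduct, N, Matrix.of_apply, Pi.zero_apply]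
      simpa only [map_sum, map_smul, smul_eq_mul, map_zero, mul_comm (g _)] using h
  rw [hpeval] at hvan
  change (pairingMatrix b e' F.1).det * (N F).det = 0 at hvan
  rw [hNF, hb] at hvan
  simp at hvan

theorem apolarIdeal_smul {c : ℂ} (hc : c ≠ 0) (F : Module.Dual ℂ X.Cox) :
    X.apolarIdeal (c • F) = X.apolarIdeal F := by
  ext s
  simp [mem_apolarIdeal, hc]

end SmoothToric

theorem mainTheorem10 {n : ℕ} {ι : Type*} [Fintype ι] (X : SmoothToric n ι) (L : X.Pic)
    (hL : X.IsVeryAmple L) (F : X.dualPiece L) (hF : F ≠ 0)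
    (hmin : X.HasMinimalBorderRank L F hF) (i : ι)
    (hi : X.borderRank L (Projectivization.mk ℂ F hF) =
      (Module.finrank ℂ (X.H0 (X.deg i)) : ℕ∞)) :
    X.borderRank L (Projectivization.mk ℂ F hF) ≤
      (Module.finrank ℂ (X.H0 L ⧸
        (X.piece (X.apolarIdeal F.1) (L - X.deg i) * X.H0 (X.deg i)).submoduleOf (X.H0 L)) :
        ℕ∞) := by
  set P := Projectivization.mk ℂ F hF
  obtain ⟨r, hPr, hr⟩ : ∃ r : ℕ, P ∈ X.secantVariety L r ∧
      r ≤ Module.finrank ℂ (X.H0 (X.deg i)) := by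
    have h : X.borderRank L P < ((Module.finrank ℂ (X.H0 (X.deg i)) + 1 : ℕ) : ℕ∞) := by
      rw [hi]
      exact_mod_cast Nat.lt_succ_self _
    simp only [SmoothToric.borderRank, iInf_lt_iff] at h
    obtain ⟨r, hr, hlt⟩ := h
    exact ⟨r, hr, Nat.lt_succ_iff.1 (by exact_mod_cast hlt)⟩
  have hDE : L - X.deg i + X.deg i = L := sub_add_cancel _ _
  -- The representative `P.rep` is a nonzero multiple of `F`, so it has the same apolar ideal.
  obtain ⟨a, ha⟩ := (Projectivization.mk_eq_mk_iff ℂ _ _ P.rep_nonzero hF).1 P.mk_rep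
  have hap : X.apolarIdeal P.rep.1 = X.apolarIdeal F.1 := by
    rw [← ha]
    exact SmoothToric.apolarIdeal_smul a.ne_zero _
  have key := SmoothToric.finrank_add_finrank_mul_le hDE hPr hr (by rw [hap]; exact hmin.1 i)
  rw [hap] at key
  set W := X.piece (X.apolarIdeal F.1) (L - X.deg i) * X.H0 (X.deg i) with hW
  have hWL : W ≤ X.H0 L := by
    rw [hW, Submodule.mul_le]
    intro k hk y hy
    exact SmoothToric.mul_mem_H0 hDE hk.2 hy
  have hq := Submodule.finrank_quotient_add_finrank (W.submoduleOf (X.H0 L))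
  rw [(Submodule.submoduleOfEquivOfLe hWL).finrank_eq] at hq
  rw [hi]
  exact_mod_cast (by omega : Module.finrank ℂ (X.H0 (X.deg i)) ≤ _)
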